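/- Let $\vec\sigma=(\sigma_1,\sigma_2,\dots)$ be a sequence of nonnegative real numbers. The weight of a permutation $\pi$ of $[n]=\{1,\dots,n\}$ is $w(\pi)=\prod_{i=1}^n\sigma_i^{c_i(\pi)}$, where $c_i(\pi)$ is the number of cycles of $\pi$ of length $i$ (fixed points being cycles of length $1$). A random $\vec\sigma$-weighted permutation of $[n]$ is a random permutation that equals $\pi$ with probability $w(\pi)/\sum_{\pi'}w(\pi')$, the sum being over all permutations $\pi'$ of $[n]$; this is defined when the sum is positive. For $R>1$ and $0<\phi<\pi/2$ put $$\Delta(\phi,R)=\{z\in\mathbb C : |z|<R,\ z\ne 1,\ |\arg(z-1)|>\phi\},$$ where $\arg$ takes values in $(-\pi,\pi]$. Theorem. Suppose that, for some $R>1$ and $0<\phi<\pi/2$, there is an analytic function $G$ on $\Delta(\phi,R)$ with $G(z)=\sum_{k\ge1}\sigma_kz^k/k$ (a convergent series) for all $z$ near $0$, and that for some constants $\sigma>0$ and $K\in\mathbb C$ $$G(z)=\sigma\log\frac1{1-z}+K+o(1)\qquad\text{as } z\to1,\ z\in\Delta(\phi,R),$$ where $\log$ is the principal branch. Let $0\le\gamma\le\delta\le1$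 be constants. Then $\sum_{\pi}w(\pi)>0$ for all sufficiently large $n$, and the probability that a uniformly random element of $[n]$, chosen independently of a random $\vec\sigma$-weighted permutation of $[n]$, lies in a cycle of this permutation whose length is in $[\gamma n,\delta n]$ tends to $(1-\gamma)^\sigma-(1-\delta)^\sigma$ as $n\to\infty$. -/

import Mathlib

open Filter Topology

namespace WeightedPerm

/-- The number `c_i(π)` of cycles of length `i` of a permutation `π` of `[n]`, where the fixed
points count as cycles of length `1` (`Equiv.Perm.partition` is the multiset of the lengths of all
cycles, fixed points included). -/
def cycleCount {n : ℕ} (π : Equiv.Perm (Fin n)) (i : ℕ) : ℕ :=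
  π.partition.parts.count i

/-- The length of the cycle of `π` that contains `x`. -/
def cycleLength {n : ℕ} (π : Equiv.Perm (Fin n)) (x : Fin n) : ℕ :=
  (Finset.univ.filter (fun y : Fin n => π.SameCycle x y)).card

/-- The weight `∏_{i=1}^n s_i ^ {c_i(π)}` of `π` with respect to the weighting sequence
`(s_1, s_2, …)`; the value `s 0` is never used. -/
noncomputable def weight (s : ℕ → ℝ) {n : ℕ} (π : Equiv.Perm (Fin n)) : ℝ :=
  ∏ i ∈ Finset.Icc 1 n, s i ^ cycleCount π i

/-- The sum of the weights of all permutations of `[n]`. -/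
noncomputable def totalWeight (s : ℕ → ℝ) (n : ℕ) : ℝ :=
  ∑ π : Equiv.Perm (Fin n), weight s π

/-- The probability of `π` under the measure that gives to each permutation of `[n]` a probability
proportional to its weight (meaningful when `0 < totalWeight s n`). -/
noncomputable def prob (s : ℕ → ℝ) {n : ℕ} (π : Equiv.Perm (Fin n)) : ℝ :=
  weight s π / totalWeight s n

/-- The probability that a uniformly random element `x` of `[n]` lies in a cycle of length in
`[γ n, δ n]` of a random weighted permutation `π` of `[n]`, with `x` and `π` independent: each pair
`(π, x)` has probability `prob s π * (1 / n)`. -/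
noncomputable def cycleLengthProb (s : ℕ → ℝ) (n : ℕ) (γ δ : ℝ) : ℝ :=
  ∑ p ∈ (Finset.univ : Finset (Equiv.Perm (Fin n) × Fin n)).filter
      (fun p => γ * (n : ℝ) ≤ (cycleLength p.1 p.2 : ℝ) ∧
        (cycleLength p.1 p.2 : ℝ) ≤ δ * (n : ℝ)),
    prob s p.1 * (1 / (n : ℝ))

/-- The domain `Δ(φ, R) = {z : |z| < R, z ≠ 1, |arg (z - 1)| > φ}`. -/
def deltaDomain (φ R : ℝ) : Set ℂ :=
  {z : ℂ | ‖z‖ < R ∧ z ≠ 1 ∧ φ < |Complex.arg (z - 1)|}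

end WeightedPerm

namespace WeightedPerm

/-! The proof has an analytic half and a Tauberian half.

Subtracting the logarithm and `K` from `G` leaves a function `f` that tends to 0 at 1 and has
coefficients `(s n - σ) / n` for `n ≥ 1`. Cauchy's estimate on discs of radius proportional to `|1 -
z|` gives `f'' = o(|1 - z|⁻²)` in the unit disc, up to a constant. Averaging over the circle `|z| =
n / (n + 1)` then yields `s n → σ` (`tendsto_weights_of_log_singularity`).

Put `p n = totalWeight s n / n!`. Removing the cycle of a marked element shows that it has length
`k` with probability `s k * p (n - k) / (n * p n)` (`sum_weight_mul_card_cycleLength`); summing over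
`k` gives a recurrence for `p`. Since `s k → σ`, it forces `n * p n ∼ σ * T n` with `T n = ∑_{j<n} p
j`, so `T` is regularly varying of index `σ` (`tendsto_div_rpow_of_tendsto_nat_mul_diff`). The
window of lengths is asymptotically an increment of `T` between about `(1 - δ) n` and `(1 - γ) n`,
divided by `T n` (`tendsto_window_sum`). -/

/-! ### Coefficient bounds from the growth of the second derivative -/

theorem iteratedDeriv_eq_of_hasSum {f : ℂ → ℂ} {a : ℕ → ℂ}
    (h : ∀ᶠ z in 𝓝 (0 : ℂ), HasSum (fun k => a k * z ^ k) (f z)) (n : ℕ) :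
    iteratedDeriv n f 0 = n.factorial * a n := by
  have hp : HasFPowerSeriesAt f (FormalMultilinearSeries.ofScalars ℂ a) 0 := by
    rw [hasFPowerSeriesAt_iff']
    filter_upwards [h] with z hz
    simpa [FormalMultilinearSeries.coeff_ofScalars, mul_comm] using hz
  obtain ⟨r, hr⟩ := hp
  have := hr.factorial_smul (1 : ℂ) n
  rw [iteratedFDeriv_apply_eq_iteratedDeriv_mul_prod, Finset.prod_const_one, one_smul] at this
  rw [← this, FormalMultilinearSeries.ofScalars_apply_eq]
  simp

/-- For `|ζ| = 1` one has `|1 - rζ| = |ζ - r|`, so `(1 - r²) / |1 - rζ|²` is the Poisson kernel at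
`r`, which has mean 1. -/
theorem circleAverage_inv_norm_one_sub_sq {r : ℝ} (h0 : 0 ≤ r) (h1 : r < 1) :
    Real.circleAverage (fun z : ℂ => (‖1 - z‖ ^ 2)⁻¹) 0 r = (1 - r ^ 2)⁻¹ := by
  have hd : DiffContOnCl ℂ (fun _ : ℂ => (1 : ℂ)) (Metric.ball 0 1) := diffContOnCl_const
  have hw : (r : ℂ) ∈ Metric.ball (0 : ℂ) 1 := by simpa [abs_of_nonneg h0] using h1
  have key := hd.circleAverage_poissonKernel_smul' hw
  have hne : (1 : ℝ) - r ^ 2 ≠ 0 := by nlinarith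
  have hnorm (θ : ℝ) : ‖1 - circleMap 0 r θ‖ = ‖circleMap 0 1 θ - r‖ := by
    have h2 : ‖circleMap 0 1 θ‖ = 1 := by simp
    have h3 : 1 - circleMap 0 r θ = circleMap 0 1 θ * (starRingEnd ℂ) (circleMap 0 1 θ - r) := by
      rw [map_sub, mul_sub, Complex.mul_conj, Complex.normSq_eq_norm_sq, h2]
      simp [circleMap, mul_comm]
    rw [h3, norm_mul, h2, one_mul, Complex.norm_conj]
  have hre := congrArg Complex.re key
  rw [Real.circleAverage_def] at hre ⊢
  simp only [hnorm]
  have hint : (∫ θ in 0..2 * Real.pi, ((‖circleMap 0 1 θ - 0‖ ^ 2 - ‖(r : ℂ) - 0‖ ^ 2) /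
      ‖circleMap 0 1 θ - 0 - (r - 0)‖ ^ 2) • (1 : ℂ)) =
      ((∫ θ in 0..2 * Real.pi, (1 - r ^ 2) * (‖circleMap 0 1 θ - r‖ ^ 2)⁻¹ : ℝ) : ℂ) := by
    rw [← intervalIntegral.integral_ofReal]
    refine intervalIntegral.integral_congr fun θ _ => ?_
    simp [abs_of_nonneg h0, div_eq_mul_inv]
  rw [hint, intervalIntegral.integral_const_mul] at hre
  rw [Complex.smul_re, Complex.ofReal_re, Complex.one_re] at hre
  simp only [smul_eq_mul] at hre ⊢
  refine eq_inv_of_mul_eq_one_left ?_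
  refine Eq.trans ?_ hre
  ring

/-- Cauchy's coefficient formula needs only the mean of `|g|` on the circle. The mean of `|1 - z|⁻²`
is of order `(1 - r)⁻¹`, whereas its supremum is `(1 - r)⁻²`; this saved factor is essential. -/
theorem norm_iteratedDeriv_le_of_norm_le_inv_sq {g : ℂ → ℂ} {ε C r : ℝ}
    (hg : DifferentiableOn ℂ g (Metric.ball 0 1))
    (hb : ∀ z ∈ Metric.ball (0 : ℂ) 1, ‖g z‖ ≤ ε * (‖1 - z‖ ^ 2)⁻¹ + C)
    (h0 : 0 < r) (h1 : r < 1) (n : ℕ) :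
    ‖iteratedDeriv n g 0‖ ≤ n.factorial * ((ε * (1 - r ^ 2)⁻¹ + C) * r⁻¹ ^ n) := by
  have hsub : Metric.closedBall (0 : ℂ) r ⊆ Metric.ball 0 1 := Metric.closedBall_subset_ball h1
  have hgr : DifferentiableOn ℂ g (Metric.closedBall 0 (NNReal.mk r h0.le)) := hg.mono hsub
  have := (hgr.hasFPowerSeriesOnBall (by exact_mod_cast h0)).factorial_smul (1 : ℂ) n
  rw [iteratedFDeriv_apply_eq_iteratedDeriv_mul_prod, Finset.prod_const_one, one_smul] at this
  rw [← this, nsmul_eq_mul, norm_mul, Complex.norm_natCast]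
  gcongr
  refine (ContinuousMultilinearMap.le_opNorm _ _).trans ?_
  simp only [norm_one, Finset.prod_const_one, mul_one]
  refine (norm_cauchyPowerSeries_le _ _ _ _).trans ?_
  rw [NNReal.coe_mk, abs_of_pos h0]
  gcongr
  have hmem (θ : ℝ) : circleMap 0 r θ ∈ Metric.ball (0 : ℂ) 1 :=
    hsub (circleMap_mem_closedBall 0 h0.le θ)
  have hcont : Continuous fun θ : ℝ => (‖1 - circleMap 0 r θ‖ ^ 2)⁻¹ := by
    refine Continuous.inv₀ (by fun_prop) fun θ h => ?_
    have h2 := hmem θ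
    have h3 : 1 - circleMap 0 r θ = 0 := by simpa using h
    rw [← sub_eq_zero.mp h3] at h2
    simp at h2
  calc (2 * Real.pi)⁻¹ * ∫ θ in 0..2 * Real.pi, ‖g (circleMap 0 r θ)‖
      ≤ (2 * Real.pi)⁻¹ * ∫ θ in 0..2 * Real.pi, (ε * (‖1 - circleMap 0 r θ‖ ^ 2)⁻¹ + C) := by
        gcongr
        refine intervalIntegral.integral_mono_on (by positivity) ?_ ?_ fun θ _ => hb _ (hmem θ)
        · refine Continuous.intervalIntegrable ?_ _ _
          exact (hg.continuousOn.comp_continuous (continuous_circleMap 0 r) hmem).norm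
        · exact ((continuous_const.mul hcont).add continuous_const).intervalIntegrable _ _
    _ = ε * Real.circleAverage (fun z : ℂ => (‖1 - z‖ ^ 2)⁻¹) 0 r + C := by
        rw [intervalIntegral.integral_add ((hcont.intervalIntegrable _ _).const_mul ε)
          (by simp), intervalIntegral.integral_const_mul, Real.circleAverage_def]
        simp only [intervalIntegral.integral_const, smul_eq_mul, sub_zero]
        field_simp
    _ = _ := by rw [circleAverage_inv_norm_one_sub_sq h0.le h1]

theorem tendsto_natCast_mul_coeff_of_second_deriv {f : ℂ → ℂ} {a : ℕ → ℂ}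
    (h : ∀ᶠ z in 𝓝 (0 : ℂ), HasSum (fun k => a k * z ^ k) (f z))
    (hd : DifferentiableOn ℂ (iteratedDeriv 2 f) (Metric.ball 0 1))
    (hb : ∀ ε > 0, ∃ C, ∀ z ∈ Metric.ball (0 : ℂ) 1,
      ‖iteratedDeriv 2 f z‖ ≤ ε * (‖1 - z‖ ^ 2)⁻¹ + C) :
    Tendsto (fun n : ℕ => (n : ℂ) * a n) atTop (𝓝 0) := by
  have hcoef (n : ℕ) : iteratedDeriv n (iteratedDeriv 2 f) 0 =
      n.factorial * ((n + 1 : ℂ) * ((n + 2 : ℂ) * a (n + 2))) := by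
    have h1 : iteratedDeriv n (iteratedDeriv 2 f) = iteratedDeriv (n + 2) f := by
      simp only [iteratedDeriv_eq_iterate, Function.iterate_add_apply]
    rw [h1, iteratedDeriv_eq_of_hasSum h, Nat.factorial_succ, Nat.factorial_succ]
    push_cast
    ring
  have hmain : ∀ ε > 0, ∃ C, ∀ n : ℕ, 1 ≤ n →
      ‖((n + 2 : ℕ) : ℂ) * a (n + 2)‖ ≤ Real.exp 1 * (ε + C * (1 / ((n : ℝ) + 1))) := by
    intro ε hε
    obtain ⟨C, hC⟩ := hb ε hε
    refine ⟨C, fun n hn => ?_⟩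
    have hn' : (0 : ℝ) < n := by exact_mod_cast hn
    -- With this radius `r⁻¹ ^ n ≤ e`, while `(1 - r²)⁻¹ ≤ n + 1`.
    set r : ℝ := n / (n + 1) with hr
    have hr0 : 0 < r := by positivity
    have hr1 : r < 1 := by rw [hr, div_lt_one (by positivity)]; linarith
    -- `C` may be negative; the bound at `z = 0` gives the sign that is needed.
    have hCnn : 0 ≤ ε + C := by
      have := hC 0 (by simp)
      simp only [sub_zero, norm_one, one_pow, inv_one, mul_one] at this
      exact (norm_nonneg _).trans this
    have key := norm_iteratedDeriv_le_of_norm_le_inv_sq hd hC hr0 hr1 n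
    rw [hcoef, norm_mul, Complex.norm_natCast] at key
    have hf : (0 : ℝ) < n.factorial := by exact_mod_cast n.factorial_pos
    have key2 := le_of_mul_le_mul_left key hf
    have hexp : r⁻¹ ^ n ≤ Real.exp 1 := by
      have h2 : r⁻¹ ≤ Real.exp (1 / n) := by
        have := Real.add_one_le_exp (1 / (n : ℝ))
        rw [hr, inv_div, add_div, div_self hn'.ne']
        linarith
      calc r⁻¹ ^ n ≤ Real.exp (1 / n) ^ n := by gcongr
        _ = Real.exp 1 := by rw [← Real.exp_nat_mul]; field_simp
    have hinv : (1 - r ^ 2)⁻¹ ≤ (n : ℝ) + 1 := by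
      rw [inv_le_comm₀ (by nlinarith) (by positivity)]
      have : ((n : ℝ) + 1)⁻¹ = 1 - r := by rw [hr]; field_simp; ring
      rw [this]; nlinarith
    have hone : 1 ≤ (1 - r ^ 2)⁻¹ := by
      rw [one_le_inv₀ (by nlinarith)]; nlinarith
    have hnorm : ‖(n + 1 : ℂ)‖ = n + 1 := by exact_mod_cast Complex.norm_natCast (n + 1)
    rw [norm_mul, hnorm] at key2
    have hpos : (0 : ℝ) < n + 1 := by positivity
    have hcast : ((n + 2 : ℕ) : ℂ) = n + 2 := by push_cast; ring
    rw [hcast]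
    refine le_of_mul_le_mul_left (key2.trans ?_) hpos
    have h3 : (n + 1 : ℝ) * (Real.exp 1 * (ε + C * (1 / ((n : ℝ) + 1)))) =
        (ε * (n + 1) + C) * Real.exp 1 := by field_simp
    rw [h3]
    refine mul_le_mul (by gcongr) hexp (by positivity) ?_
    nlinarith
  rw [← tendsto_add_atTop_iff_nat 2, tendsto_zero_iff_norm_tendsto_zero]
  rw [Metric.tendsto_atTop']
  intro ε hε
  obtain ⟨C, hC⟩ := hmain (ε / 2 / Real.exp 1) (by positivity)
  have hlim : Tendsto (fun n : ℕ => Real.exp 1 * (ε / 2 / Real.exp 1 + C * (1 / ((n : ℝ) + 1))))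
      atTop (𝓝 (Real.exp 1 * (ε / 2 / Real.exp 1 + C * 0))) :=
    ((tendsto_one_div_add_atTop_nhds_zero_nat.const_mul C).const_add _).const_mul _
  have hlt : Real.exp 1 * (ε / 2 / Real.exp 1 + C * 0) < ε := by
    rw [mul_zero, add_zero, mul_div_cancel₀ _ (Real.exp_pos 1).ne']; linarith
  obtain ⟨N, hN⟩ := eventually_atTop.mp (hlim.eventually (gt_mem_nhds hlt))
  refine ⟨max N 1, fun n hn => ?_⟩
  have hn1 : N ≤ n := (le_max_left _ _).trans hn.le
  have hn2 : 1 ≤ n := (le_max_right _ _).trans hn.le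
  simpa using (hC n hn2).trans_lt (hN n hn1)

/-! ### Geometry of the Delta domain and Cauchy estimates near 1 -/

theorem mem_deltaDomain_of_re_lt {φ R : ℝ} (hφ : 0 < φ) (hφ' : φ < Real.pi / 2) {z : ℂ}
    (hz : ‖z‖ < R) (hre : (z - 1).re < Real.cos φ * ‖z - 1‖) : z ∈ deltaDomain φ R := by
  refine ⟨hz, ?_, ?_⟩
  · rintro rfl
    simp at hre
  · have hpos : 0 < ‖z - 1‖ := by
      rw [norm_pos_iff]
      intro h
      simp [h] at hre
    rw [← Complex.norm_mul_cos_arg, mul_comm, mul_lt_mul_iff_left₀ hpos, ← Real.cos_abs] at hre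
    by_contra! hle
    exact absurd hre (not_lt.mpr (Real.cos_le_cos_of_nonneg_of_le_pi (abs_nonneg _)
      (by linarith [Real.pi_pos]) hle))

theorem re_sub_one_nonpos_of_norm_le_one {z : ℂ} (hz : ‖z‖ ≤ 1) (hz1 : z ≠ 1) :
    (z - 1).re < 0 := by
  by_contra! h
  have h1 : 1 ≤ z.re := by simpa using h
  have h2 : z.re ≤ ‖z‖ := Complex.re_le_norm z
  have h3 : z.re = 1 := by linarith
  have h4 := Complex.sq_norm_sub_sq_re z
  have h5 : ‖z‖ = 1 := by linarith
  rw [h3, h5] at h4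
  refine hz1 (Complex.ext (by simpa using h3) ?_)
  have : z.im ^ 2 = 0 := by linarith
  simpa using this

theorem mem_deltaDomain_of_norm_le_one {φ R : ℝ} (hφ : 0 < φ) (hφ' : φ < Real.pi / 2)
    (hR : 1 < R) {z : ℂ} (hz : ‖z‖ ≤ 1) (hz1 : z ≠ 1) : z ∈ deltaDomain φ R := by
  refine mem_deltaDomain_of_re_lt hφ hφ' (by linarith)
    ((re_sub_one_nonpos_of_norm_le_one hz hz1).trans_le ?_)
  have : 0 < Real.cos φ := Real.cos_pos_of_mem_Ioo ⟨by linarith, hφ'⟩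
  positivity

/-- The unit disc lies in the half-plane `Re (z - 1) < 0`, which meets the excluded sector `|arg (z
- 1)| ≤ φ < π / 2` nowhere; its distance from that sector therefore scales like `|z - 1|`. -/
theorem exists_closedBall_subset_deltaDomain {φ R : ℝ} (hφ : 0 < φ) (hφ' : φ < Real.pi / 2)
    (hR : 1 < R) : ∃ c : ℝ, 0 < c ∧ c < 1 ∧ ∀ z : ℂ, ‖z‖ < 1 →
      Metric.closedBall z (c * ‖z - 1‖) ⊆ deltaDomain φ R := by
  have hcos : 0 < Real.cos φ := Real.cos_pos_of_mem_Ioo ⟨by linarith, hφ'⟩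
  have hcos1 : Real.cos φ ≤ 1 := Real.cos_le_one φ
  -- The first bound keeps the ball off the sector; the second keeps it inside `|w| < R`, as `|z -
  -- 1| ≤ 2`.
  set c := min (Real.cos φ / 4) ((R - 1) / 2)
  have hc0 : 0 < c := lt_min (by linarith) (by linarith)
  have hc1 : c ≤ Real.cos φ / 4 := min_le_left _ _
  have hc2 : c ≤ (R - 1) / 2 := min_le_right _ _
  refine ⟨c, hc0, by linarith, fun z hz w hw => ?_⟩
  rw [mem_closedBall_iff_norm] at hw
  have hz1 : z ≠ 1 := by rintro rfl; simp at hz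
  have hzpos : 0 < ‖z - 1‖ := norm_pos_iff.mpr (sub_ne_zero.mpr hz1)
  have hz2 : ‖z - 1‖ ≤ 2 := (norm_sub_le _ _).trans (by rw [norm_one]; linarith)
  have hre := re_sub_one_nonpos_of_norm_le_one hz.le hz1
  refine mem_deltaDomain_of_re_lt hφ hφ' ?_ ?_
  · have := norm_sub_norm_le w z
    nlinarith
  · have h1 : (w - 1).re = (w - z).re + (z - 1).re := by simp
    have h2 : (w - z).re ≤ ‖w - z‖ := Complex.re_le_norm _
    have h3 : ‖z - 1‖ ≤ ‖w - 1‖ + ‖w - z‖ := by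
      have := norm_sub_le (w - 1) (w - z)
      simpa using this
    have h4 : (1 - c) * ‖z - 1‖ ≤ ‖w - 1‖ := by linarith
    have h5 : c * ‖z - 1‖ < Real.cos φ * ((1 - c) * ‖z - 1‖) := by
      rw [← mul_assoc]
      gcongr
      nlinarith
    nlinarith

theorem differentiableOn_iteratedDeriv_two_of_deltaDomain {φ R : ℝ} (hφ : 0 < φ)
    (hφ' : φ < Real.pi / 2) (hR : 1 < R) {f : ℂ → ℂ} (hf : AnalyticOnNhd ℂ f (deltaDomain φ R)) :
    DifferentiableOn ℂ (iteratedDeriv 2 f) (Metric.ball 0 1) := by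
  rw [iteratedDeriv_eq_iterate]
  refine (hf.iterated_deriv 2).differentiableOn.mono fun z hz => ?_
  rw [mem_ball_zero_iff] at hz
  exact mem_deltaDomain_of_norm_le_one hφ hφ' hR hz.le (by rintro rfl; simp at hz)

theorem norm_iteratedDeriv_two_le_of_tendsto_zero {φ R : ℝ} (hφ : 0 < φ)
    (hφ' : φ < Real.pi / 2) (hR : 1 < R) {f : ℂ → ℂ} (hf : AnalyticOnNhd ℂ f (deltaDomain φ R))
    (hlim : Tendsto f (𝓝[deltaDomain φ R] (1 : ℂ)) (𝓝 0)) (ε : ℝ) (hε : 0 < ε) :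
    ∃ C, ∀ z ∈ Metric.ball (0 : ℂ) 1, ‖iteratedDeriv 2 f z‖ ≤ ε * (‖1 - z‖ ^ 2)⁻¹ + C := by
  obtain ⟨c, hc0, hc1, hc⟩ := exists_closedBall_subset_deltaDomain hφ hφ' hR
  -- Cauchy's estimate multiplies this by `2! / (c |z - 1|)²`, leaving exactly `ε |z - 1|⁻²`. Away
  -- from 1, compactness provides `C`.
  obtain ⟨η, hη, hsmall⟩ := Metric.tendsto_nhdsWithin_nhds.mp hlim (ε * c ^ 2 / 2) (by positivity)
  have hcpt : IsCompact (Metric.closedBall (0 : ℂ) 1 \ Metric.ball 1 (η / 2)) :=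
    (isCompact_closedBall 0 1).diff Metric.isOpen_ball
  have hcont : ContinuousOn (iteratedDeriv 2 f)
      (Metric.closedBall (0 : ℂ) 1 \ Metric.ball 1 (η / 2)) := by
    rw [iteratedDeriv_eq_iterate]
    refine (hf.iterated_deriv 2).continuousOn.mono fun z hz => ?_
    refine mem_deltaDomain_of_norm_le_one hφ hφ' hR (by simpa using hz.1) ?_
    rintro rfl
    exact hz.2 (Metric.mem_ball_self (by linarith))
  obtain ⟨C, hC⟩ := hcpt.exists_bound_of_continuousOn hcont
  refine ⟨max C 0, fun z hz => ?_⟩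
  have hz' : ‖z‖ < 1 := by simpa using hz
  by_cases hnear : z ∈ Metric.ball (1 : ℂ) (η / 2)
  · have hz1 : z ≠ 1 := by rintro rfl; simp at hz'
    have hzpos : 0 < ‖z - 1‖ := norm_pos_iff.mpr (sub_ne_zero.mpr hz1)
    have hr : 0 < c * ‖z - 1‖ := by positivity
    have hsub := hc z hz'
    have hd : DiffContOnCl ℂ f (Metric.ball z (c * ‖z - 1‖)) :=
      (hf.differentiableOn.mono (Metric.closure_ball_subset_closedBall.trans hsub)).diffContOnCl
    have hbound : ∀ w ∈ Metric.sphere z (c * ‖z - 1‖), ‖f w‖ ≤ ε * c ^ 2 / 2 := by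
      intro w hw
      have hw' := Metric.sphere_subset_closedBall hw
      have hdist : dist w 1 < η := by
        have h1 := dist_triangle w z 1
        rw [Metric.mem_sphere] at hw
        rw [Metric.mem_ball] at hnear
        rw [hw] at h1
        rw [← dist_eq_norm] at h1
        nlinarith [dist_nonneg (x := z) (y := (1 : ℂ))]
      simpa using (hsmall (hsub hw') hdist).le
    have key := Complex.norm_iteratedDeriv_le_of_forall_mem_sphere_norm_le 2 hr hd hbound
    refine key.trans ?_
    rw [norm_sub_rev 1 z]
    have : ((Nat.factorial 2 : ℕ) : ℝ) * (ε * c ^ 2 / 2) / (c * ‖z - 1‖) ^ 2 =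
        ε * (‖z - 1‖ ^ 2)⁻¹ := by
      simp only [Nat.factorial]
      field_simp
      norm_num
    rw [this]
    exact le_add_of_nonneg_right (le_max_right _ _)
  · refine (hC z ⟨by simpa using hz'.le, hnear⟩).trans ((le_max_left C 0).trans ?_)
    exact le_add_of_nonneg_left (by positivity)

theorem tendsto_weights_of_log_singularity {s : ℕ → ℝ} {σ : ℝ} {K : ℂ}
    {φ R : ℝ} (hφ : 0 < φ) (hφ' : φ < Real.pi / 2) (hR : 1 < R)
    {G : ℂ → ℂ} (hG : AnalyticOnNhd ℂ G (deltaDomain φ R))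
    (hsum : ∀ᶠ z in 𝓝 (0 : ℂ),
      HasSum (fun k : ℕ => (s (k + 1) : ℂ) * z ^ (k + 1) / ((k : ℂ) + 1)) (G z))
    (hlim : Tendsto (fun z : ℂ => G z - ((σ : ℂ) * Complex.log (1 / (1 - z)) + K))
      (𝓝[deltaDomain φ R] (1 : ℂ)) (𝓝 0)) :
    Tendsto s atTop (𝓝 σ) := by
  have hslit {z : ℂ} (hz : z ∈ deltaDomain φ R) : 1 - z ∈ Complex.slitPlane := by
    rw [Complex.mem_slitPlane_iff]
    by_contra! h
    have h1 : (z - 1).arg = 0 := by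
      rw [Complex.arg_eq_zero_iff]
      have h2 : 1 - z.re ≤ 0 := by simpa using h.1
      have h3 : z.im = 0 := by simpa using h.2
      constructor
      · simp; linarith
      · simp [h3]
    have h2 := hz.2.2
    rw [h1, abs_zero] at h2
    linarith
  set f : ℂ → ℂ := fun z => G z + σ * Complex.log (1 - z) - K with hfdef
  have hf : AnalyticOnNhd ℂ f (deltaDomain φ R) := by
    intro z hz
    have := hslit hz
    have h1 := hG z hz
    have h2 : AnalyticAt ℂ (fun z : ℂ => 1 - z) z := by fun_prop
    exact (h1.add (analyticAt_const.mul (h2.clog this))).sub analyticAt_const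
  have hflim : Tendsto f (𝓝[deltaDomain φ R] (1 : ℂ)) (𝓝 0) := by
    refine hlim.congr' ?_
    filter_upwards [self_mem_nhdsWithin] with z hz
    rw [one_div, Complex.log_inv _ (Complex.slitPlane_arg_ne_pi (hslit hz))]
    simp only [hfdef]
    ring
  -- The series of `G` and of the logarithm have no constant term, so only `-K` remains at index 0.
  set a : ℕ → ℂ := fun n => if n = 0 then -K else ((s n : ℂ) - σ) / n with hadef
  have ha : ∀ᶠ z in 𝓝 (0 : ℂ), HasSum (fun k => a k * z ^ k) (f z) := by
    filter_upwards [hsum, Metric.ball_mem_nhds (0 : ℂ) one_pos] with z hz hz1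
    have h1 := hz.add
      ((Complex.hasSum_taylorSeries_neg_log' (by simpa using hz1)).mul_left (-(σ : ℂ)))
    rw [← hasSum_nat_add_iff' 1]
    convert! h1 using 1
    · funext k
      simp [hadef]
      ring
    · simp [hadef, hfdef]
  have key := tendsto_natCast_mul_coeff_of_second_deriv ha
    (differentiableOn_iteratedDeriv_two_of_deltaDomain hφ hφ' hR hf)
    (norm_iteratedDeriv_two_le_of_tendsto_zero hφ hφ' hR hf hflim)
  have h2 : Tendsto (fun n : ℕ => ((s n - σ : ℝ) : ℂ)) atTop (𝓝 0) := by
    refine key.congr' ?_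
    filter_upwards [eventually_ne_atTop 0] with n hn
    have : (n : ℂ) ≠ 0 := by exact_mod_cast hn
    simp only [hadef, hn, if_false]
    push_cast
    field_simp
  have h3 := (Complex.continuous_re.tendsto 0).comp h2
  simpa using! tendsto_sub_nhds_zero_iff.mp h3

/-! ### Tauberian argument and regular variation -/

/-- Where `n - j` is large, `u (n - j)` is small. Only boundedly many other `j` remain, each
contributing `o(T n)` because `p n = o(T (n + 1))` and `T` is monotone. -/
theorem tendsto_sum_weighted_zero {u p T : ℕ → ℝ} (hu0 : ∀ k, 0 ≤ u k)
    (hu : Tendsto u atTop (𝓝 0)) (hp : ∀ n, 0 ≤ p n) (hT : ∀ n, T n = ∑ j ∈ Finset.range n, p j)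
    (hTpos : ∀ n, 0 < T (n + 1)) (hpT : Tendsto (fun n => p n / T (n + 1)) atTop (𝓝 0)) :
    Tendsto (fun n => (∑ j ∈ Finset.range n, u (n - j) * p j) / T n) atTop (𝓝 0) := by
  have hTmono : Monotone T := by
    refine monotone_nat_of_le_succ fun n => ?_
    rw [hT, hT, Finset.sum_range_succ]
    linarith [hp n]
  obtain ⟨B, hB⟩ := hu.bddAbove_range
  have hB' (k : ℕ) : u k ≤ B := hB ⟨k, rfl⟩
  have hB0 : 0 ≤ B := (hu0 0).trans (hB' 0)
  rw [Metric.tendsto_atTop']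
  intro ε hε
  obtain ⟨M, hM⟩ := eventually_atTop.mp (hu.eventually (gt_mem_nhds (half_pos hε)))
  have hlim : Tendsto (fun n => ε / 2 + B * ∑ i ∈ Finset.range M, p (n - 1 - i) / T (n - 1 - i + 1))
      atTop (𝓝 (ε / 2 + B * ∑ i ∈ Finset.range M, 0)) := by
    refine ((tendsto_finsetSum _ fun i _ => ?_).const_mul B).const_add _
    exact hpT.comp ((tendsto_sub_atTop_nat i).comp (tendsto_sub_atTop_nat 1))
  have hlt : ε / 2 + B * ∑ i ∈ Finset.range M, (0 : ℝ) < ε := by simp; linarith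
  obtain ⟨N, hN⟩ := eventually_atTop.mp (hlim.eventually (gt_mem_nhds hlt))
  refine ⟨max N (M + 1), fun n hn => ?_⟩
  have hn1 : N ≤ n := (le_max_left _ _).trans hn.le
  have hn2 : M + 1 < n := (le_max_right _ _).trans_lt hn
  obtain ⟨m, rfl⟩ : ∃ m, n = m + 1 := ⟨n - 1, by omega⟩
  have hTn := hTpos m
  have hnn : 0 ≤ (∑ j ∈ Finset.range (m + 1), u (m + 1 - j) * p j) / T (m + 1) :=
    div_nonneg (Finset.sum_nonneg fun j _ => mul_nonneg (hu0 _) (hp _)) hTn.le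
  rw [Real.dist_0_eq_abs, abs_of_nonneg hnn]
  refine lt_of_le_of_lt ?_ (hN _ hn1)
  rw [div_le_iff₀ hTn, add_mul, mul_assoc, Finset.sum_mul]
  have hsum : ∑ j ∈ Finset.range (m + 1), u (m + 1 - j) * p j ≤
      ∑ i ∈ Finset.range (m + 1), (ε / 2 * p (m - i) + if i < M then B * p (m - i) else 0) := by
    rw [← Finset.sum_range_reflect]
    refine Finset.sum_le_sum fun i hi => ?_
    rw [Finset.mem_range] at hi
    rw [show m + 1 - 1 - i = m - i by omega, show m + 1 - (m - i) = i + 1 by omega]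
    split_ifs with h
    · have := mul_le_mul_of_nonneg_right (hB' (i + 1)) (hp (m - i))
      have := mul_nonneg hε.le (hp (m - i))
      linarith
    · have := mul_le_mul_of_nonneg_right (hM (i + 1) (by omega)).le (hp (m - i))
      linarith
  refine hsum.trans ?_
  rw [Finset.sum_add_distrib, ← Finset.mul_sum]
  refine add_le_add ?_ ?_
  · rw [hT, ← Finset.sum_range_reflect p]
    simp
  · rw [← Finset.sum_filter, Finset.mul_sum]
    have hfil : (Finset.range (m + 1)).filter (fun i => i < M) = Finset.range M := by
      ext i; simp; omega
    rw [hfil]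
    refine Finset.sum_le_sum fun i hi => ?_
    rw [Finset.mem_range] at hi
    rw [show m + 1 - 1 - i = m - i by omega]
    gcongr
    rw [div_mul_eq_mul_div, le_div_iff₀ (hTpos _)]
    exact mul_le_mul_of_nonneg_left (hTmono (by omega)) (hp _)

/-- Telescope from `m n` to `n`: there are at most `n` increments, each at most `η / m n`, and `n /
m n` stays bounded because `x > 0`. -/
theorem tendsto_sub_zero_of_tendsto_nat_mul_diff {v : ℕ → ℝ}
    (hv : Tendsto (fun n : ℕ => n * (v (n + 1) - v n)) atTop (𝓝 0)) {m : ℕ → ℕ} {x : ℝ}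
    (hx : 0 < x) (hm : ∀ n, m n ≤ n)
    (hmx : Tendsto (fun n => (m n : ℝ) / n) atTop (𝓝 x)) :
    Tendsto (fun n => v (m n) - v n) atTop (𝓝 0) := by
  rw [Metric.tendsto_atTop']
  intro ε hε
  set η := ε * (x / 2) / 2
  have hη : 0 < η := by positivity
  obtain ⟨N, hN⟩ := Metric.tendsto_atTop.mp hv η hη
  have h1 : ∀ᶠ n in atTop, x / 2 < (m n : ℝ) / n := hmx.eventually (lt_mem_nhds (by linarith))
  obtain ⟨k, hk⟩ := exists_nat_gt ((N : ℝ) / (x / 2))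
  obtain ⟨N', hN'⟩ := eventually_atTop.mp (h1.and (eventually_ge_atTop (k + 1)))
  refine ⟨N', fun n hn => ?_⟩
  obtain ⟨hn1, hn2⟩ := hN' n hn.le
  have hn0 : (0 : ℝ) < n := by exact_mod_cast (by omega : 0 < n)
  rw [lt_div_iff₀ hn0] at hn1
  have hmN : N ≤ m n := by
    have h3 : (k : ℝ) ≤ n := by exact_mod_cast (by omega : k ≤ n)
    rw [div_lt_iff₀ (by positivity)] at hk
    have : (N : ℝ) < m n := by nlinarith
    exact_mod_cast this.le
  have hmpos : (0 : ℝ) < m n := lt_trans (by positivity) hn1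
  rw [Real.dist_0_eq_abs, ← Real.dist_eq]
  refine (dist_le_Ico_sum_of_dist_le (hm n) (d := fun _ => η / m n) fun {j} hj _ => ?_).trans_lt ?_
  · have := hN j (hmN.trans hj)
    rw [Real.dist_0_eq_abs, abs_mul, abs_of_nonneg (Nat.cast_nonneg j)] at this
    rw [dist_comm, Real.dist_eq, le_div_iff₀ hmpos, mul_comm]
    refine le_trans ?_ this.le
    gcongr
  · rw [Finset.sum_const, Nat.card_Ico, nsmul_eq_mul, ← mul_div_assoc, div_lt_iff₀ hmpos]
    have h3 : ((n - m n : ℕ) : ℝ) ≤ n := by exact_mod_cast Nat.sub_le _ _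
    calc ((n - m n : ℕ) : ℝ) * η ≤ n * η := by gcongr
      _ < ε * m n := by simp only [η]; nlinarith

/-- The increments of `log (T n) - σ * log n` are `o(1 / n)`, so for `x > 0` the previous lemma
applies. For `x = 0`, monotonicity compares `m n` with `⌈y * n⌉₊` for a small `y > 0`. -/
theorem tendsto_div_rpow_of_tendsto_nat_mul_diff {T : ℕ → ℝ} {σ : ℝ} (hσ : 0 < σ)
    (hTpos : ∀ n, 0 < T (n + 1)) (hTmono : Monotone T) (hT0 : 0 ≤ T 0)
    (hreg : Tendsto (fun n : ℕ => n * ((T (n + 1) - T n) / T n)) atTop (𝓝 σ))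
    {m : ℕ → ℕ} {x : ℝ} (hx : 0 ≤ x) (hm : ∀ n, m n ≤ n)
    (hmx : Tendsto (fun n => (m n : ℝ) / n) atTop (𝓝 x)) :
    Tendsto (fun n => T (m n) / T n) atTop (𝓝 (x ^ σ)) := by
  have hTpos' {n : ℕ} (hn : 0 < n) : 0 < T n := by
    obtain ⟨k, rfl⟩ : ∃ k, n = k + 1 := ⟨n - 1, by omega⟩
    exact hTpos k
  have hpos : ∀ {m : ℕ → ℕ} {x : ℝ}, 0 < x → (∀ n, m n ≤ n) →
      Tendsto (fun n => (m n : ℝ) / n) atTop (𝓝 x) →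
      Tendsto (fun n => T (m n) / T n) atTop (𝓝 (x ^ σ)) := by
    intro m x hx hm hmx
    set v : ℕ → ℝ := fun n => Real.log (T n) - σ * Real.log n with hvdef
    have hv : Tendsto (fun n : ℕ => n * (v (n + 1) - v n)) atTop (𝓝 0) := by
      have h1 := Real.tendsto_nat_mul_log_one_add_of_tendsto hreg
      have h2 : Tendsto (fun n : ℕ => (n : ℝ) * (1 / (n : ℝ))) atTop (𝓝 1) := by
        refine tendsto_const_nhds.congr' ?_
        filter_upwards [eventually_ne_atTop 0] with n hn
        field_simp
      have h3 := (Real.tendsto_nat_mul_log_one_add_of_tendsto h2).const_mul σ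
      have h4 := h1.sub h3
      rw [mul_one, sub_self] at h4
      refine h4.congr' ?_
      filter_upwards [eventually_gt_atTop 0] with n hn
      have hn' : (0 : ℝ) < n := by exact_mod_cast hn
      have e1 : 1 + (T (n + 1) - T n) / T n = T (n + 1) / T n := by
        have := (hTpos' hn).ne'
        field_simp
        ring
      have e2 : 1 + 1 / (n : ℝ) = ((n + 1 : ℕ) : ℝ) / n := by
        push_cast
        field_simp
      rw [e1, e2, Real.log_div (hTpos n).ne' (hTpos' hn).ne',
        Real.log_div (by positivity) hn'.ne']
      simp only [hvdef]
      ring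
    have h1 := tendsto_sub_zero_of_tendsto_nat_mul_diff hv hx hm hmx
    have h2 := ((Real.continuousAt_log hx.ne').tendsto.comp hmx).const_mul σ
    have h3 := (Real.continuous_exp.tendsto _).comp (h1.add h2)
    rw [zero_add, mul_comm, ← Real.rpow_def_of_pos hx] at h3
    refine h3.congr' ?_
    filter_upwards [eventually_gt_atTop 0, hmx.eventually (lt_mem_nhds hx)] with n hn hmn
    have hn' : (0 : ℝ) < n := by exact_mod_cast hn
    have hmn' : (0 : ℝ) < m n := by
      rcases (Nat.cast_nonneg (α := ℝ) (m n)).eq_or_lt with h | h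
      · rw [← h, zero_div] at hmn
        exact absurd hmn (lt_irrefl _)
      · exact h
    have hT1 := hTpos' hn
    have hT2 := hTpos' (n := m n) (by exact_mod_cast hmn')
    simp only [Function.comp_apply, hvdef]
    rw [Real.log_div hmn'.ne' hn'.ne', ← Real.exp_log (div_pos hT2 hT1),
      Real.log_div hT2.ne' hT1.ne']
    congr 1
    ring
  rcases hx.eq_or_lt with rfl | hx
  · rw [Real.zero_rpow hσ.ne', Metric.tendsto_atTop']
    intro ε hε
    obtain ⟨y, hy0, hy1, hyε⟩ : ∃ y : ℝ, 0 < y ∧ y ≤ 1 ∧ y ^ σ < ε := by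
      have h1 : Tendsto (fun y : ℝ => y ^ σ) (𝓝[>] 0) (𝓝 0) := by
        have := (Real.continuousAt_rpow_const 0 σ (Or.inr hσ.le)).tendsto
        rw [Real.zero_rpow hσ.ne'] at this
        exact this.mono_left nhdsWithin_le_nhds
      have h2 := (h1.eventually (gt_mem_nhds hε)).and
        (Ioc_mem_nhdsGT (zero_lt_one' ℝ))
      obtain ⟨y, hy, hy'⟩ := h2.exists
      exact ⟨y, hy'.1, hy'.2, hy⟩
    have hc : ∀ n : ℕ, ⌈y * n⌉₊ ≤ n := fun n => by
      rw [Nat.ceil_le]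
      nlinarith [Nat.cast_nonneg (α := ℝ) n]
    have h1 := hpos hy0 hc
      ((tendsto_nat_ceil_mul_div_atTop hy0.le).comp tendsto_natCast_atTop_atTop)
    obtain ⟨N, hN⟩ := eventually_atTop.mp (((h1.eventually (gt_mem_nhds hyε)).and
      (hmx.eventually (gt_mem_nhds hy0))).and (eventually_gt_atTop 0))
    refine ⟨N, fun n hn => ?_⟩
    obtain ⟨⟨hn1, hn2⟩, hn3⟩ := hN n hn.le
    have hn' : (0 : ℝ) < n := by exact_mod_cast hn3
    rw [div_lt_iff₀ hn'] at hn2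
    have hle : m n ≤ ⌈y * n⌉₊ := by exact_mod_cast hn2.le.trans (Nat.le_ceil _)
    have hT := hTpos' hn3
    have hTm : 0 ≤ T (m n) := hT0.trans (hTmono (Nat.zero_le _))
    rw [Real.dist_0_eq_abs, abs_of_nonneg (by positivity)]
    refine lt_of_le_of_lt ?_ hn1
    gcongr
    exact hTmono hle
  · exact hpos hx hm hmx

/-- If `p` is nonnegative with `p 0 = 1` and `n p_n = ∑_{j<n} s_{n-j} p_j`, where `s_k` tends to
`σ > 0`, then the terms with `γ n ≤ n - j ≤ δ n` make up a share of this sum that tends to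
`(1 - γ)^σ - (1 - δ)^σ`. -/
theorem tendsto_window_sum {s p : ℕ → ℝ} {σ γ δ : ℝ} (hs : ∀ k, 1 ≤ k → 0 ≤ s k) (hσ : 0 < σ)
    (hlim : Tendsto s atTop (𝓝 σ)) (hp : ∀ n, 0 ≤ p n) (hp0 : p 0 = 1)
    (hrec : ∀ n : ℕ, n * p n = ∑ j ∈ Finset.range n, s (n - j) * p j)
    (hγ : 0 ≤ γ) (hγδ : γ ≤ δ) (hδ : δ ≤ 1) :
    Tendsto (fun n : ℕ => (∑ j ∈ (Finset.range n).filter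
        (fun j => γ * (n : ℝ) ≤ ((n - j : ℕ) : ℝ) ∧ ((n - j : ℕ) : ℝ) ≤ δ * (n : ℝ)),
        s (n - j) * p j) / (n * p n)) atTop (𝓝 ((1 - γ) ^ σ - (1 - δ) ^ σ)) := by
  set T : ℕ → ℝ := fun n => ∑ j ∈ Finset.range n, p j with hTdef
  have hTmono : Monotone T := by
    refine monotone_nat_of_le_succ fun n => ?_
    simp only [hTdef, Finset.sum_range_succ]
    linarith [hp n]
  have hTone (n : ℕ) : 1 ≤ T (n + 1) := by
    have : T 1 ≤ T (n + 1) := hTmono (by omega)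
    simpa [hTdef, hp0] using this
  have hTpos (n : ℕ) : 0 < T (n + 1) := one_pos.trans_le (hTone n)
  have hTpos' {n : ℕ} (hn : 0 < n) : 0 < T n := by
    obtain ⟨k, rfl⟩ : ∃ k, n = k + 1 := ⟨n - 1, by omega⟩
    exact hTpos k
  have hpT : Tendsto (fun n => p n / T (n + 1)) atTop (𝓝 0) := by
    obtain ⟨C, hC⟩ := hlim.bddAbove_range
    have hC' (k : ℕ) : s k ≤ C := hC ⟨k, rfl⟩
    refine squeeze_zero' (Eventually.of_forall fun n => div_nonneg (hp n) (hTpos n).le) ?_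
      (tendsto_const_div_atTop_nhds_zero_nat C)
    filter_upwards [eventually_gt_atTop 0] with n hn
    have hn' : (0 : ℝ) < n := by exact_mod_cast hn
    have hC0 : 0 ≤ C := (hs n hn).trans (hC' n)
    rw [div_le_div_iff₀ (hTpos n) hn', mul_comm, hrec]
    calc ∑ j ∈ Finset.range n, s (n - j) * p j ≤ ∑ j ∈ Finset.range n, C * p j :=
          Finset.sum_le_sum fun j _ => mul_le_mul_of_nonneg_right (hC' _) (hp j)
      _ = C * T n := by rw [← Finset.mul_sum]
      _ ≤ C * T (n + 1) := mul_le_mul_of_nonneg_left (hTmono (by omega)) hC0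
  have habs : Tendsto (fun k => |s k - σ|) atTop (𝓝 0) := by
    have := (hlim.sub_const σ).abs
    rwa [sub_self, abs_zero] at this
  have hweight := tendsto_sum_weighted_zero (fun _ => abs_nonneg _) habs hp (fun _ => rfl)
    hTpos hpT
  -- Replacing `s (n - j)` by `σ` costs `o(T n)` on any index set; this serves both the full range
  -- and the window.
  have herr (F : ℕ → Finset ℕ) (hF : ∀ n, F n ⊆ Finset.range n) :
      Tendsto (fun n => (∑ j ∈ F n, s (n - j) * p j) / T n - σ * ((∑ j ∈ F n, p j) / T n))
        atTop (𝓝 0) := by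
    refine squeeze_zero_norm' ?_ hweight
    filter_upwards [eventually_gt_atTop 0] with n hn
    have hT := hTpos' hn
    rw [← mul_div_assoc, ← sub_div, Real.norm_eq_abs, abs_div, abs_of_pos hT, Finset.mul_sum,
      ← Finset.sum_sub_distrib]
    gcongr
    calc |∑ j ∈ F n, (s (n - j) * p j - σ * p j)|
        ≤ ∑ j ∈ F n, |s (n - j) * p j - σ * p j| := Finset.abs_sum_le_sum_abs _ _
      _ = ∑ j ∈ F n, |s (n - j) - σ| * p j :=
          Finset.sum_congr rfl fun j _ => by rw [← sub_mul, abs_mul, abs_of_nonneg (hp j)]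
      _ ≤ ∑ j ∈ Finset.range n, |s (n - j) - σ| * p j :=
          Finset.sum_le_sum_of_subset_of_nonneg (hF n)
            fun j _ _ => mul_nonneg (abs_nonneg _) (hp j)
  have hreg : Tendsto (fun n : ℕ => n * p n / T n) atTop (𝓝 σ) := by
    have h1 := (herr Finset.range fun _ => subset_rfl).add_const σ
    rw [zero_add] at h1
    refine h1.congr' ?_
    filter_upwards [eventually_gt_atTop 0] with n hn
    rw [hrec, show (∑ j ∈ Finset.range n, p j) = T n from rfl, div_self (hTpos' hn).ne']
    ring
  have hreg' : Tendsto (fun n : ℕ => n * ((T (n + 1) - T n) / T n)) atTop (𝓝 σ) := by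
    refine hreg.congr fun n => ?_
    simp only [hTdef, Finset.sum_range_succ]
    ring
  set F : ℕ → Finset ℕ := fun n => (Finset.range n).filter
    (fun j => γ * (n : ℝ) ≤ ((n - j : ℕ) : ℝ) ∧ ((n - j : ℕ) : ℝ) ≤ δ * (n : ℝ)) with hFdef
  set a : ℕ → ℕ := fun n => ⌈(1 - δ) * n⌉₊ with hadef
  -- The `+ 1` makes the right end exclusive; the cap at `n` matters when `γ = 0`, since `j < n`.
  set b : ℕ → ℕ := fun n => min n (⌊(1 - γ) * n⌋₊ + 1) with hbdef
  have han (n : ℕ) : a n ≤ n := by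
    simp only [hadef, Nat.ceil_le]
    nlinarith [Nat.cast_nonneg (α := ℝ) n]
  have hab (n : ℕ) : a n ≤ b n := by
    refine le_min (han n) ?_
    simp only [hadef, Nat.ceil_le]
    have h1 := Nat.lt_floor_add_one ((1 - γ) * (n : ℝ))
    have h2 : (1 - δ) * (n : ℝ) ≤ (1 - γ) * n := by gcongr
    push_cast
    linarith
  have hFI (n : ℕ) : F n = Finset.Ico (a n) (b n) := by
    ext j
    simp only [hFdef, hadef, hbdef, Finset.mem_filter, Finset.mem_range, Finset.mem_Ico,
      lt_min_iff, Nat.ceil_le, Nat.lt_succ_iff]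
    have hf : j ≤ ⌊(1 - γ) * (n : ℝ)⌋₊ ↔ (j : ℝ) ≤ (1 - γ) * n :=
      Nat.le_floor_iff (by nlinarith [Nat.cast_nonneg (α := ℝ) n])
    rw [hf]
    constructor
    · rintro ⟨h, h1, h2⟩
      rw [Nat.cast_sub h.le] at h1 h2
      exact ⟨by linarith, h, by linarith⟩
    · rintro ⟨h1, h, h2⟩
      rw [Nat.cast_sub h.le]
      exact ⟨h, by linarith, by linarith⟩
  have hlima : Tendsto (fun n => T (a n) / T n) atTop (𝓝 ((1 - δ) ^ σ)) :=
    tendsto_div_rpow_of_tendsto_nat_mul_diff hσ hTpos hTmono (by simp [hTdef]) hreg'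
      (by linarith) han
      ((tendsto_nat_ceil_mul_div_atTop (by linarith)).comp tendsto_natCast_atTop_atTop)
  have hlimb : Tendsto (fun n => T (b n) / T n) atTop (𝓝 ((1 - γ) ^ σ)) := by
    refine tendsto_div_rpow_of_tendsto_nat_mul_diff hσ hTpos hTmono (by simp [hTdef]) hreg'
      (by linarith) (fun n => min_le_left _ _) ?_
    have h1 : Tendsto (fun n : ℕ => (⌊(1 - γ) * (n : ℝ)⌋₊ : ℝ) / n + 1 / n) atTop
        (𝓝 ((1 - γ) + 0)) :=
      ((tendsto_nat_floor_mul_div_atTop (by linarith)).comp tendsto_natCast_atTop_atTop).add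
        tendsto_one_div_atTop_nhds_zero_nat
    have h2 := (tendsto_const_nhds (x := (1 : ℝ)) (f := (atTop : Filter ℕ))).min h1
    rw [add_zero, min_eq_right (by linarith)] at h2
    refine h2.congr' ?_
    filter_upwards [eventually_gt_atTop 0] with n hn
    have hn' : (0 : ℝ) < n := by exact_mod_cast hn
    simp only [hbdef]
    push_cast
    rw [← min_div_div_right hn'.le, div_self hn'.ne', add_div]
  have hnum : Tendsto (fun n => (∑ j ∈ F n, s (n - j) * p j) / T n) atTop
      (𝓝 (σ * ((1 - γ) ^ σ - (1 - δ) ^ σ))) := by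
    have h1 := (herr F fun n => Finset.filter_subset _ _).add ((hlimb.sub hlima).const_mul σ)
    rw [zero_add] at h1
    refine h1.congr fun n => ?_
    rw [hFI, Finset.sum_Ico_eq_sub p (hab n), sub_div]
    ring
  have h := hnum.div hreg hσ.ne'
  rw [mul_div_cancel_left₀ _ hσ.ne'] at h
  refine h.congr' ?_
  filter_upwards [eventually_gt_atTop 0] with n hn
  exact div_div_div_cancel_right₀ (hTpos' hn).ne' _ _

/-! ### Counting permutations by cycle type -/

/-- The order of the centralizer of a permutation whose cycle lengths form the multiset `m`. -/
def centralizerOrder (m : Multiset ℕ) : ℕ :=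
  m.prod * ∏ i ∈ m.toFinset, (m.count i).factorial

theorem centralizerOrder_cons (k : ℕ) (m : Multiset ℕ) :
    centralizerOrder (k ::ₘ m) = k * (m.count k + 1) * centralizerOrder m := by
  have h1 : ∏ i ∈ (k ::ₘ m).toFinset, ((k ::ₘ m).count i).factorial =
      (m.count k + 1) * ∏ i ∈ insert k m.toFinset, (m.count i).factorial := by
    rw [Multiset.toFinset_cons, ← Finset.mul_prod_erase _ _ (Finset.mem_insert_self k m.toFinset),
      ← Finset.mul_prod_erase (insert k m.toFinset) (fun i => (m.count i).factorial)
        (Finset.mem_insert_self k m.toFinset), Multiset.count_cons_self, Nat.factorial_succ, mul_assoc]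
    congr 2
    refine Finset.prod_congr rfl fun i hi => ?_
    rw [Multiset.count_cons_of_ne (Finset.ne_of_mem_erase hi)]
  have h2 : ∏ i ∈ insert k m.toFinset, (m.count i).factorial =
      ∏ i ∈ m.toFinset, (m.count i).factorial := by
    refine (Finset.prod_subset (Finset.subset_insert _ _) fun i _ hi => ?_).symm
    rw [Multiset.mem_toFinset] at hi
    rw [Multiset.count_eq_zero_of_notMem hi, Nat.factorial_zero]
  rw [centralizerOrder, h1, h2, Multiset.prod_cons, centralizerOrder]
  ring

theorem centralizerOrder_pos {m : Multiset ℕ} (h : ∀ i ∈ m, 0 < i) : 0 < centralizerOrder m :=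
  Nat.mul_pos (Multiset.prod_pos h) (Finset.prod_pos fun _ _ => Nat.factorial_pos _)

theorem filter_not_two_le_eq_replicate {m : Multiset ℕ} (h : ∀ i ∈ m, 0 < i) :
    m.filter (fun i => ¬ 2 ≤ i) = Multiset.replicate (m.count 1) 1 := by
  rw [← Multiset.filter_eq']
  refine Multiset.filter_congr fun i hi => ?_
  have := h i hi
  omega

/-- This is the class formula for `Equiv.Perm.cycleType`, which omits fixed points; the parts equal
to 1 are split off and restored through `centralizerOrder_cons`. -/
theorem card_filter_partition_mul {n : ℕ} (l : n.Partition) :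
    (Finset.univ.filter fun π : Equiv.Perm (Fin n) => π.partition.parts = l.parts).card *
      centralizerOrder l.parts = n.factorial := by
  set m := l.parts.filter (fun i => 2 ≤ i) with hm
  have hsplit : l.parts = m + Multiset.replicate (l.parts.count 1) 1 := by
    conv_lhs => rw [← Multiset.filter_add_not (fun i => 2 ≤ i) l.parts]
    rw [filter_not_two_le_eq_replicate fun i hi => l.parts_pos hi]
  have hsum : m.sum + l.parts.count 1 = n := by
    have := congrArg Multiset.sum hsplit
    rw [l.parts_sum, Multiset.sum_add, Multiset.sum_replicate, smul_eq_mul, mul_one] at this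
    exact this.symm
  have hfil : (Finset.univ.filter fun π : Equiv.Perm (Fin n) => π.partition.parts = l.parts) =
      Finset.univ.filter fun π : Equiv.Perm (Fin n) => π.cycleType = m := by
    ext π
    simp only [Finset.mem_filter, Finset.mem_univ, true_and]
    constructor
    · intro h
      rw [← Equiv.Perm.filter_parts_partition_eq_cycleType, h]
    · intro h
      rw [Equiv.Perm.parts_partition, ← Equiv.Perm.sum_cycleType, h, hsplit, Fintype.card_fin]
      congr 2
      omega
  have hm1 : m.count 1 = 0 := by
    rw [Multiset.count_eq_zero, hm, Multiset.mem_filter]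
    omega
  have hz : centralizerOrder l.parts =
      (n - m.sum).factorial * m.prod * ∏ i ∈ m.toFinset, (m.count i).factorial := by
    have hgen (c : ℕ) : centralizerOrder (m + Multiset.replicate c 1) =
        c.factorial * centralizerOrder m := by
      induction c with
      | zero => simp
      | succ c ih =>
        rw [Multiset.replicate_succ, Multiset.add_cons, centralizerOrder_cons, ih,
          Multiset.count_add, hm1, Multiset.count_replicate_self, Nat.factorial_succ]
        ring
    rw [hsplit, hgen, centralizerOrder, mul_assoc]
    congr 2
    omega
  rw [hfil, hz]
  have := Equiv.Perm.card_of_cycleType_mul_eq (Fin n) m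
  rw [if_pos ⟨by rw [Fintype.card_fin]; omega, fun a ha => (Multiset.mem_filter.mp ha).2⟩,
    Fintype.card_fin] at this
  exact this

theorem cycleLength_of_apply_eq {n : ℕ} {π : Equiv.Perm (Fin n)} {x : Fin n} (h : π x = x) :
    cycleLength π x = 1 := by
  rw [cycleLength, Finset.card_eq_one]
  refine ⟨x, ?_⟩
  ext y
  simp only [Finset.mem_filter, Finset.mem_univ, true_and, Finset.mem_singleton]
  constructor
  · intro hs
    exact (hs.eq_of_left h).symm
  · rintro rfl
    exact Equiv.Perm.SameCycle.refl _ _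

theorem cycleLength_of_apply_ne {n : ℕ} {π : Equiv.Perm (Fin n)} {x : Fin n} (h : π x ≠ x) :
    cycleLength π x = (π.cycleOf x).support.card := by
  rw [cycleLength]
  congr 1
  ext y
  simp [Equiv.Perm.mem_support_cycleOf_iff' h]

theorem card_filter_cycleLength_eq {n : ℕ} (π : Equiv.Perm (Fin n)) {k : ℕ} (hk : 1 ≤ k) :
    (Finset.univ.filter fun x : Fin n => cycleLength π x = k).card =
      k * π.partition.parts.count k := by
  have htwo {x : Fin n} (h : π x ≠ x) : 2 ≤ cycleLength π x := by
    rw [cycleLength_of_apply_ne h]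
    exact Equiv.Perm.two_le_card_support_cycleOf_iff.mpr h
  rw [Equiv.Perm.parts_partition, Multiset.count_add, Multiset.count_replicate]
  rcases hk.eq_or_lt with rfl | hk
  · have h1 : π.cycleType.count 1 = 0 :=
      Multiset.count_eq_zero.mpr fun h => absurd (Equiv.Perm.two_le_of_mem_cycleType h) (by omega)
    have h2 : (Finset.univ.filter fun x : Fin n => cycleLength π x = 1) = π.supportᶜ := by
      ext x
      simp only [Finset.mem_filter, Finset.mem_univ, true_and, Finset.mem_compl,
        Equiv.Perm.mem_support, not_not]
      constructor
      · intro h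
        by_contra hne
        have := htwo hne
        omega
      · exact cycleLength_of_apply_eq
    rw [h1, h2, Finset.card_compl]
    simp
  · rw [if_neg (by omega), add_zero, Equiv.Perm.cycleType_def, Multiset.count_map]
    have hmaps : Set.MapsTo π.cycleOf
        (Finset.univ.filter fun x : Fin n => cycleLength π x = k : Finset (Fin n))
        (π.cycleFactorsFinset.filter fun c => k = c.support.card :
          Finset (Equiv.Perm (Fin n))) := by
      intro x hx
      have hx' : cycleLength π x = k := by simpa using hx
      have hne : π x ≠ x := fun h => by rw [cycleLength_of_apply_eq h] at hx'; omega
      rw [cycleLength_of_apply_ne hne] at hx'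
      simp only [Finset.coe_filter, Set.mem_ofPred_eq,
        Equiv.Perm.cycleOf_mem_cycleFactorsFinset_iff, Equiv.Perm.mem_support]
      exact ⟨hne, hx'.symm⟩
    rw [Finset.card_eq_sum_card_fiberwise hmaps]
    have hfib : ∀ c ∈ π.cycleFactorsFinset.filter (fun c => k = c.support.card),
        ((Finset.univ.filter fun x : Fin n => cycleLength π x = k).filter
          fun x => π.cycleOf x = c).card = k := by
      intro c hc
      obtain ⟨hc1, hc2⟩ := Finset.mem_filter.mp hc
      conv_rhs => rw [hc2]
      congr 1
      ext x
      simp only [Finset.mem_filter, Finset.mem_univ, true_and]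
      constructor
      · rintro ⟨h1, rfl⟩
        rw [Equiv.Perm.mem_support_cycleOf_iff]
        refine ⟨Equiv.Perm.SameCycle.refl _ _, Equiv.Perm.mem_support.mpr fun h => ?_⟩
        rw [cycleLength_of_apply_eq h] at h1
        omega
      · intro hx
        have h1 := Equiv.Perm.cycle_is_cycleOf hx hc1
        have hne : π x ≠ x :=
          Equiv.Perm.mem_support.mp (Equiv.Perm.mem_cycleFactorsFinset_support_le hc1 hx)
        exact ⟨by rw [cycleLength_of_apply_ne hne, ← h1, hc2], h1.symm⟩
    rw [Finset.sum_congr rfl hfib, Finset.sum_const, smul_eq_mul, mul_comm]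
    rfl

theorem weight_eq_prod_map (s : ℕ → ℝ) {n : ℕ} (π : Equiv.Perm (Fin n)) :
    weight s π = (π.partition.parts.map s).prod := by
  rw [Finset.prod_multiset_map_count, weight]
  refine (Finset.prod_subset (fun i hi => ?_) fun i _ hi => ?_).symm
  · rw [Multiset.mem_toFinset] at hi
    rw [Finset.mem_Icc]
    refine ⟨π.partition.parts_pos hi, ?_⟩
    have := Multiset.le_sum_of_mem hi
    rwa [π.partition.parts_sum, Fintype.card_fin] at this
  · rw [Multiset.mem_toFinset] at hi
    rw [cycleCount, Multiset.count_eq_zero_of_notMem hi, pow_zero]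

theorem sum_perm_eq_sum_partition (n : ℕ) (f : Multiset ℕ → ℝ) :
    ∑ π : Equiv.Perm (Fin n), f π.partition.parts =
      n.factorial * ∑ l : n.Partition, f l.parts / centralizerOrder l.parts := by
  let g : Equiv.Perm (Fin n) → n.Partition := fun π =>
    ⟨π.partition.parts, fun h => π.partition.parts_pos h,
      π.partition.parts_sum.trans (Fintype.card_fin n)⟩
  rw [← Finset.sum_fiberwise Finset.univ g, Finset.mul_sum]
  refine Finset.sum_congr rfl fun l _ => ?_
  have h1 : (Finset.univ.filter fun π => g π = l) =
      Finset.univ.filter fun π : Equiv.Perm (Fin n) => π.partition.parts = l.parts := by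
    ext π
    simp [g, Nat.Partition.ext_iff]
  have hpos : (0 : ℝ) < centralizerOrder l.parts := by
    exact_mod_cast centralizerOrder_pos fun i hi => l.parts_pos hi
  rw [h1, Finset.sum_congr rfl (g := fun _ => f l.parts)
    fun π hπ => by rw [(Finset.mem_filter.mp hπ).2], Finset.sum_const, nsmul_eq_mul,
    ← card_filter_partition_mul l]
  push_cast
  field_simp

theorem totalWeight_eq (s : ℕ → ℝ) (n : ℕ) :
    totalWeight s n = n.factorial *
      ∑ l : n.Partition, (l.parts.map s).prod / centralizerOrder l.parts := by
  rw [← sum_perm_eq_sum_partition n fun m => (m.map s).prod, totalWeight]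
  exact Finset.sum_congr rfl fun π _ => weight_eq_prod_map s π

/-- Adjoining a part `k` is a bijection from partitions of `n - k` to partitions of `n` containing
`k`. The factor `k * count k` cancels the change in the centralizer order. -/
theorem sum_partition_count (s : ℕ → ℝ) {n k : ℕ} (hk : 1 ≤ k) (hkn : k ≤ n) :
    ∑ l : n.Partition, (l.parts.map s).prod * ((k * l.parts.count k : ℕ) : ℝ) /
        centralizerOrder l.parts =
      s k * ∑ l : (n - k).Partition, (l.parts.map s).prod / centralizerOrder l.parts := by
  rw [← Finset.sum_filter_of_ne (p := fun l : n.Partition => k ∈ l.parts) (fun l _ h => by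
    by_contra hmem
    rw [Multiset.count_eq_zero_of_notMem hmem] at h
    simp at h), Finset.mul_sum]
  refine (Finset.sum_bij (fun (l : (n - k).Partition) _ =>
    (⟨k ::ₘ l.parts, fun {i} hi => ?_, ?_⟩ : n.Partition)) (fun l _ => ?_) (fun l₁ _ l₂ _ h => ?_)
    (fun l hl => ?_) (fun l _ => ?_)).symm
  · rcases Multiset.mem_cons.mp hi with rfl | hi
    · exact hk
    · exact l.parts_pos hi
  · rw [Multiset.sum_cons, l.parts_sum]
    omega
  · simp
  · rw [Nat.Partition.ext_iff] at h ⊢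
    simpa using h
  · have hl' : k ∈ l.parts := (Finset.mem_filter.mp hl).2
    refine ⟨⟨l.parts.erase k, fun {i} hi => l.parts_pos (Multiset.mem_of_mem_erase hi), ?_⟩,
      Finset.mem_univ _, ?_⟩
    · have := congrArg Multiset.sum (Multiset.cons_erase hl')
      rw [Multiset.sum_cons, l.parts_sum] at this
      omega
    · rw [Nat.Partition.ext_iff]
      exact Multiset.cons_erase hl'
  · have hpos : (0 : ℝ) < centralizerOrder l.parts := by
      exact_mod_cast centralizerOrder_pos fun i hi => l.parts_pos hi
    have hk' : (0 : ℝ) < k := by exact_mod_cast hk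
    simp only [centralizerOrder_cons, Multiset.map_cons, Multiset.prod_cons,
      Multiset.count_cons_self]
    push_cast
    field_simp

/-! ### Cycle of a marked element: recurrence and exact probability -/

theorem sum_weight_mul_card_cycleLength (s : ℕ → ℝ) {n k : ℕ} (hk : 1 ≤ k) (hkn : k ≤ n) :
    ∑ π : Equiv.Perm (Fin n), weight s π *
        ((Finset.univ.filter fun x : Fin n => cycleLength π x = k).card : ℝ) =
      n.factorial * (s k * (totalWeight s (n - k) / (n - k).factorial)) := by
  have h := sum_perm_eq_sum_partition n
    fun m => (m.map s).prod * ((k * m.count k : ℕ) : ℝ)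
  rw [sum_partition_count s hk hkn] at h
  rw [totalWeight_eq, mul_div_cancel_left₀ _ (by exact_mod_cast (n - k).factorial_ne_zero), ← h]
  exact Finset.sum_congr rfl fun π _ => by
    rw [weight_eq_prod_map, card_filter_cycleLength_eq π hk]

theorem one_le_cycleLength {n : ℕ} (π : Equiv.Perm (Fin n)) (x : Fin n) : 1 ≤ cycleLength π x :=
  Finset.card_pos.mpr ⟨x, Finset.mem_filter.mpr ⟨Finset.mem_univ x, Equiv.Perm.SameCycle.refl π x⟩⟩

theorem cycleLength_le {n : ℕ} (π : Equiv.Perm (Fin n)) (x : Fin n) : cycleLength π x ≤ n :=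
  (Finset.card_le_univ _).trans (Fintype.card_fin n).le

theorem sum_weight_mul_card_filter (s : ℕ → ℝ) (n : ℕ) (Q : ℕ → Prop) [DecidablePred Q] :
    ∑ π : Equiv.Perm (Fin n), weight s π *
        ((Finset.univ.filter fun x : Fin n => Q (cycleLength π x)).card : ℝ) =
      n.factorial * ∑ j ∈ (Finset.range n).filter (fun j => Q (n - j)),
        s (n - j) * (totalWeight s j / j.factorial) := by
  have hcard (π : Equiv.Perm (Fin n)) :
      (Finset.univ.filter fun x : Fin n => Q (cycleLength π x)).card =
        ∑ j ∈ (Finset.range n).filter (fun j => Q (n - j)),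
          (Finset.univ.filter fun x : Fin n => cycleLength π x = n - j).card := by
    rw [Finset.card_eq_sum_card_fiberwise (f := fun x => n - cycleLength π x)
      (t := (Finset.range n).filter (fun j => Q (n - j)))]
    · refine Finset.sum_congr rfl fun j hj => ?_
      obtain ⟨hj1, hj2⟩ := Finset.mem_filter.mp hj
      rw [Finset.mem_range] at hj1
      congr 1
      ext x
      have h1 := cycleLength_le π x
      simp only [Finset.mem_filter, Finset.mem_univ, true_and]
      constructor
      · rintro ⟨_, h⟩
        omega
      · intro h
        rw [h]
        exact ⟨hj2, by omega⟩
    · intro x hx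
      have h1 := cycleLength_le π x
      have h2 := one_le_cycleLength π x
      simp only [Finset.coe_filter, Finset.mem_univ, true_and, Set.mem_ofPred_eq] at hx
      simp only [Finset.coe_filter, Finset.mem_range, Set.mem_ofPred_eq]
      rw [Nat.sub_sub_self h1]
      exact ⟨by omega, hx⟩
  simp only [hcard, Nat.cast_sum, Finset.mul_sum]
  rw [Finset.sum_comm]
  refine Finset.sum_congr rfl fun j hj => ?_
  have hj1 := Finset.mem_range.mp (Finset.mem_filter.mp hj).1
  rw [sum_weight_mul_card_cycleLength s (by omega) (Nat.sub_le n j), Nat.sub_sub_self hj1.le]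

/-- Every element lies in some cycle: take the always-true condition on lengths in
`sum_weight_mul_card_filter`. -/
theorem natCast_mul_totalWeight_div_factorial (s : ℕ → ℝ) (n : ℕ) :
    n * (totalWeight s n / n.factorial) =
      ∑ j ∈ Finset.range n, s (n - j) * (totalWeight s j / j.factorial) := by
  have h := sum_weight_mul_card_filter s n fun _ => True
  simp only [Finset.filter_true, Finset.card_univ, Fintype.card_fin, ← Finset.sum_mul] at h
  have hn : (n.factorial : ℝ) ≠ 0 := by exact_mod_cast n.factorial_ne_zero
  rw [← mul_div_assoc, div_eq_iff hn, mul_comm, mul_comm (Finset.sum _ _), ← h]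
  rfl

theorem cycleLengthProb_eq (s : ℕ → ℝ) (n : ℕ) (γ δ : ℝ) :
    cycleLengthProb s n γ δ = (∑ j ∈ (Finset.range n).filter
        (fun j => γ * (n : ℝ) ≤ ((n - j : ℕ) : ℝ) ∧ ((n - j : ℕ) : ℝ) ≤ δ * (n : ℝ)),
        s (n - j) * (totalWeight s j / j.factorial)) / (n * (totalWeight s n / n.factorial)) := by
  classical
  have h := sum_weight_mul_card_filter s n
    fun k => γ * (n : ℝ) ≤ (k : ℝ) ∧ (k : ℝ) ≤ δ * (n : ℝ)
  have hn : (n.factorial : ℝ) ≠ 0 := by exact_mod_cast n.factorial_ne_zero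
  have h1 : cycleLengthProb s n γ δ = (∑ π : Equiv.Perm (Fin n), weight s π *
      ((Finset.univ.filter fun x : Fin n => γ * (n : ℝ) ≤ (cycleLength π x : ℝ) ∧
        (cycleLength π x : ℝ) ≤ δ * (n : ℝ)).card : ℝ)) / (n * totalWeight s n) := by
    rw [cycleLengthProb, Finset.sum_filter, Fintype.sum_prod_type, Finset.sum_div]
    refine Finset.sum_congr rfl fun π _ => ?_
    simp only [← Finset.sum_filter, Finset.sum_const, nsmul_eq_mul, prob]
    ring
  rw [h1, h]
  field_simp

theorem weight_nonneg {s : ℕ → ℝ} (hs : ∀ k : ℕ, 1 ≤ k → 0 ≤ s k) {n : ℕ}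
    (π : Equiv.Perm (Fin n)) : 0 ≤ weight s π :=
  Finset.prod_nonneg fun _ hi => pow_nonneg (hs _ (Finset.mem_Icc.mp hi).1) _

theorem totalWeight_nonneg {s : ℕ → ℝ} (hs : ∀ k : ℕ, 1 ≤ k → 0 ≤ s k) (n : ℕ) :
    0 ≤ totalWeight s n :=
  Finset.sum_nonneg fun π _ => weight_nonneg hs π

theorem totalWeight_zero (s : ℕ → ℝ) : totalWeight s 0 = 1 := by
  simp [totalWeight, weight]

theorem totalWeight_pos_of_pos {s : ℕ → ℝ} (hs : ∀ k : ℕ, 1 ≤ k → 0 ≤ s k) {n : ℕ} (hn : 1 ≤ n)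
    (hsn : 0 < s n) : 0 < totalWeight s n := by
  have hnonneg (j : ℕ) : 0 ≤ totalWeight s j / j.factorial :=
    div_nonneg (totalWeight_nonneg hs j) (Nat.cast_nonneg _)
  have h : 0 < n * (totalWeight s n / n.factorial) := by
    rw [natCast_mul_totalWeight_div_factorial]
    -- The term `j = 0`, equal to `s n`, is already positive; it comes from the `n`-cycles.
    refine Finset.sum_pos' (fun j hj => mul_nonneg (hs _ ?_) (hnonneg j))
      ⟨0, Finset.mem_range.mpr hn, ?_⟩
    · have := Finset.mem_range.mp hj
      omega
    · simpa [totalWeight_zero] using hsn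
  by_contra! hle
  have : totalWeight s n = 0 := le_antisymm hle (totalWeight_nonneg hs n)
  simp [this] at h

end WeightedPerm

theorem mainTheorem1 (s : ℕ → ℝ) (hs : ∀ k : ℕ, 1 ≤ k → 0 ≤ s k)
    (σ : ℝ) (hσ : 0 < σ) (K : ℂ)
    (φ R : ℝ) (hφ : 0 < φ) (hφ' : φ < Real.pi / 2) (hR : 1 < R)
    (G : ℂ → ℂ) (hG : AnalyticOnNhd ℂ G (WeightedPerm.deltaDomain φ R))
    (hsum : ∀ᶠ z in 𝓝 (0 : ℂ),
      HasSum (fun k : ℕ => (s (k + 1) : ℂ) * z ^ (k + 1) / ((k : ℂ) + 1)) (G z))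
    (hlim : Tendsto (fun z : ℂ => G z - ((σ : ℂ) * Complex.log (1 / (1 - z)) + K))
      (𝓝[WeightedPerm.deltaDomain φ R] (1 : ℂ)) (𝓝 0))
    (γ δ : ℝ) (hγ : 0 ≤ γ) (hγδ : γ ≤ δ) (hδ : δ ≤ 1) :
    (∀ᶠ n : ℕ in atTop, 0 < WeightedPerm.totalWeight s n) ∧
      Tendsto (fun n : ℕ => WeightedPerm.cycleLengthProb s n γ δ) atTop
        (𝓝 ((1 - γ) ^ σ - (1 - δ) ^ σ)) := by
  have hlims := WeightedPerm.tendsto_weights_of_log_singularity hφ hφ' hR hG hsum hlim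
  constructor
  · filter_upwards [hlims.eventually (lt_mem_nhds hσ), eventually_ge_atTop 1] with n hn h1
    exact WeightedPerm.totalWeight_pos_of_pos hs h1 hn
  · refine (WeightedPerm.tendsto_window_sum (p := fun n => WeightedPerm.totalWeight s n / n.factorial)
      hs hσ hlims (fun n => ?_) ?_ (WeightedPerm.natCast_mul_totalWeight_div_factorial s)
      hγ hγδ hδ).congr fun n => (WeightedPerm.cycleLengthProb_eq s n γ δ).symm
    · exact div_nonneg (WeightedPerm.totalWeight_nonneg hs n) (Nat.cast_nonneg _)
    · simp [WeightedPerm.totalWeight_zero]
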